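/- Let $L>0$ and let $h:[-L,L]\to\mathbb{R}$ be a real-valued, even, continuous function. Let $K$ be the operator on the complex Hilbert space $L^2([0,L])$ given by $$(Kf)(x)=\int_0^L h(x-y)\,f(y)\,dy .$$ Then $K$ is a compact selfadjoint operator. Let $\lambda$ be an eigenvalue of $K$ of largest modulus, i.e. $|\mu|\le|\lambda|$ for every eigenvalue $\mu$ of $K$, and assume that $\lambda$ is simple, i.e. $\dim\ker(K-\lambda)=1$. Let $\xi\in L^2([0,L])$, $\xi\neq 0$, be an eigenvector of $K$ for $\lambda$, extended by zero outside $[0,L]$ to an element of $L^2(\mathbb{R})$. Then its Fourier transform $$\widehat{\xi}(z)=\int_{\mathbb{R}}\xi(x)\,e^{-izx}\,dx,\qquad z\in\mathbb{C},$$ is an entire function, and all its zeros are real. -/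

import Mathlib

open MeasureTheory Set

/-- The complex Hilbert space `L²([0, L])`, with respect to Lebesgue measure. -/
abbrev L2Interval (L : ℝ) : Type :=
  Lp ℂ 2 (volume.restrict (Icc (0 : ℝ) L))

/-- The function `x ↦ ∫_{[0, L]} h (x - y) f(y) dy`. -/
noncomputable def convFun (L : ℝ) (h : ℝ → ℝ) (f : ℝ → ℂ) (x : ℝ) : ℂ :=
  ∫ y in Icc (0 : ℝ) L, (h (x - y) : ℂ) * f y

theorem kernel_continuousOn {L : ℝ} {h : ℝ → ℝ} (hc : ContinuousOn h (Icc (-L) L)) :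
    ContinuousOn (fun p : ℝ × ℝ => (h (p.1 - p.2) : ℂ)) (Icc 0 L ×ˢ Icc 0 L) := by
  refine Complex.continuous_ofReal.comp_continuousOn (hc.comp (by fun_prop) ?_)
  rintro ⟨x, y⟩ ⟨⟨hx0, hx1⟩, ⟨hy0, hy1⟩⟩
  simp only [mem_Icc] at *
  constructor <;> linarith

theorem kernel_bound {L : ℝ} {h : ℝ → ℝ} (hc : ContinuousOn h (Icc (-L) L)) :
    ∃ M : ℝ, 0 ≤ M ∧ ∀ x ∈ Icc 0 L, ∀ y ∈ Icc 0 L, ‖(h (x - y) : ℂ)‖ ≤ M := by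
  obtain ⟨M, hM⟩ := (isCompact_Icc.prod isCompact_Icc).exists_bound_of_continuousOn
    (kernel_continuousOn hc)
  exact ⟨max M 0, le_max_right _ _, fun x hx y hy => (hM (x, y) ⟨hx, hy⟩).trans (le_max_left _ _)⟩

theorem kernel_mul_integrable {L : ℝ} {h : ℝ → ℝ} (hc : ContinuousOn h (Icc (-L) L))
    (f : L2Interval L) {x : ℝ} (hx : x ∈ Icc 0 L) :
    Integrable (fun y => (h (x - y) : ℂ) * f y) (volume.restrict (Icc 0 L)) := by
  obtain ⟨M, -, hM⟩ := kernel_bound hc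
  have hf : Integrable f (volume.restrict (Icc 0 L)) := (Lp.memLp f).integrable (by norm_num)
  refine hf.bdd_mul (c := M) ?_ ?_
  · have : ContinuousOn (fun y : ℝ => (h (x - y) : ℂ)) (Icc 0 L) :=
      (kernel_continuousOn hc).comp (f := fun y : ℝ => (x, y)) (by fun_prop) (fun y hy => ⟨hx, hy⟩)
    exact this.aestronglyMeasurable measurableSet_Icc
  · filter_upwards [ae_restrict_mem measurableSet_Icc] with y hy using hM x hx y hy

theorem convFun_bound {L : ℝ} {h : ℝ → ℝ} (hc : ContinuousOn h (Icc (-L) L)) :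
    ∃ C : ℝ, 0 ≤ C ∧ ∀ f : L2Interval L, ∀ x ∈ Icc 0 L, ‖convFun L h f x‖ ≤ C * ‖f‖ := by
  obtain ⟨M, hM0, hM⟩ := kernel_bound hc
  let μ : Measure ℝ := volume.restrict (Icc (0 : ℝ) L)
  refine ⟨M * (μ univ ^ (1 / (2 : ℝ))).toReal, by positivity, fun f x hx => ?_⟩
  have hf : Integrable f μ := (Lp.memLp f).integrable (by norm_num)
  have h1 : ‖convFun L h f x‖ ≤ ∫ y, M * ‖f y‖ ∂μ := by
    refine norm_integral_le_of_norm_le (hf.norm.const_mul M) ?_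
    filter_upwards [ae_restrict_mem measurableSet_Icc] with y hy
    rw [norm_mul]
    exact mul_le_mul_of_nonneg_right (hM x hx y hy) (norm_nonneg _)
  have h2 : ∫ y, ‖f y‖ ∂μ ≤ ‖f‖ * (μ univ ^ (1 / (2 : ℝ))).toReal := by
    have h3 := eLpNorm_le_eLpNorm_mul_rpow_measure_univ (p := 1) (q := 2) (μ := μ)
      (by norm_num) (Lp.aestronglyMeasurable f)
    rw [integral_norm_eq_lintegral_enorm hf.1, ← eLpNorm_one_eq_lintegral_enorm, Lp.norm_def,
      ← ENNReal.toReal_mul]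
    have h4 : (1 / (1 : ENNReal).toReal - 1 / (2 : ENNReal).toReal) = 1 / (2 : ℝ) := by norm_num
    rw [h4] at h3
    refine ENNReal.toReal_mono (ENNReal.mul_ne_top (Lp.memLp f).2.ne ?_) h3
    exact ENNReal.rpow_ne_top_of_nonneg (by norm_num) (measure_ne_top μ _)
  rw [integral_const_mul] at h1
  calc ‖convFun L h f x‖ ≤ M * ∫ y, ‖f y‖ ∂μ := h1
    _ ≤ M * (‖f‖ * (μ univ ^ (1 / (2 : ℝ))).toReal) := by gcongr
    _ = _ := by ring

theorem convFun_memLp {L : ℝ} {h : ℝ → ℝ} (hc : ContinuousOn h (Icc (-L) L))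
    (f : L2Interval L) : MemLp (convFun L h f) 2 (volume.restrict (Icc (0 : ℝ) L)) := by
  obtain ⟨C, -, hC⟩ := convFun_bound hc
  refine MemLp.of_bound ?_ (C * ‖f‖) ?_
  · refine AEStronglyMeasurable.integral_prod_right'
      (f := fun p : ℝ × ℝ => (h (p.1 - p.2) : ℂ) * f p.2) ?_
    refine AEStronglyMeasurable.mul ?_ (Lp.aestronglyMeasurable f).comp_snd
    rw [Measure.prod_restrict]
    exact (kernel_continuousOn hc).aestronglyMeasurable (measurableSet_Icc.prod measurableSet_Icc)
  · filter_upwards [ae_restrict_mem measurableSet_Icc] with x hx using hC f x hx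

/-- The operator `K` on `L²([0, L])` given by `(K f)(x) = ∫_{[0, L]} h (x - y) f(y) dy`, for a
function `h` that is continuous on `[-L, L]`. -/
noncomputable def convOp (L : ℝ) (h : ℝ → ℝ) (hc : ContinuousOn h (Icc (-L) L)) :
    L2Interval L →L[ℂ] L2Interval L :=
  LinearMap.mkContinuousOfExistsBound
    { toFun := fun f => (convFun_memLp hc f).toLp (convFun L h f)
      map_add' := by
        intro f g
        rw [← MemLp.toLp_add, MemLp.toLp_eq_toLp_iff]
        filter_upwards [ae_restrict_mem measurableSet_Icc] with x hx
        simp only [convFun, Pi.add_apply]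
        rw [← integral_add (kernel_mul_integrable hc f hx) (kernel_mul_integrable hc g hx)]
        refine integral_congr_ae ?_
        filter_upwards [Lp.coeFn_add f g] with y hy
        rw [hy, Pi.add_apply, mul_add]
      map_smul' := by
        intro c f
        rw [RingHom.id_apply, ← MemLp.toLp_const_smul, MemLp.toLp_eq_toLp_iff]
        refine Filter.Eventually.of_forall fun x => ?_
        simp only [convFun, Pi.smul_apply, smul_eq_mul]
        rw [← integral_const_mul]
        refine integral_congr_ae ?_
        filter_upwards [Lp.coeFn_smul c f] with y hy
        rw [hy, Pi.smul_apply, smul_eq_mul]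
        ring }
    (by
      obtain ⟨C, hC0, hC⟩ := convFun_bound hc
      refine ⟨(volume.restrict (Icc (0 : ℝ) L)).real univ ^ (2 : ENNReal).toReal⁻¹ * C,
        fun f => ?_⟩
      rw [mul_assoc]
      refine Lp.norm_le_of_ae_bound (by positivity) ?_
      filter_upwards [ae_restrict_mem measurableSet_Icc, (convFun_memLp hc f).coeFn_toLp]
        with x hx hfx
      exact (congrArg norm hfx).le.trans (hC f x hx))

theorem convOp_coeFn {L : ℝ} {h : ℝ → ℝ} (hc : ContinuousOn h (Icc (-L) L)) (f : L2Interval L) :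
    convOp L h hc f =ᵐ[volume.restrict (Icc (0 : ℝ) L)]
      fun x => ∫ y in Icc (0 : ℝ) L, (h (x - y) : ℂ) * f y :=
  (convFun_memLp hc f).coeFn_toLp

/-- The extension of `f ∈ L²([0, L])` to the real line by zero outside `[0, L]`. -/
noncomputable def extendByZero {L : ℝ} (f : L2Interval L) : ℝ → ℂ :=
  (Icc (0 : ℝ) L).indicator f

/-- The Fourier transform at complex arguments, `ĝ(z) = ∫_ℝ g(x) exp(-i z x) dx`. -/
noncomputable def complexFourier (g : ℝ → ℂ) (z : ℂ) : ℂ :=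
  ∫ x : ℝ, g x * Complex.exp (-Complex.I * z * (x : ℂ))

/-!
Write `T = c - K`, where `K = convOp L h` and `c` is the given eigenvalue, which is real. The proof
divides the Fourier transform of `ξ` by `w - z` at a zero `z`.

Since `K` is compact and selfadjoint, `‖K‖` is the modulus of an eigenvalue, so `‖K‖ ≤ |c|`. Hence
`T` (or `-T`, if `c < 0`) is a positive operator, and `⟪u, T u⟫ = 0` only for `u` in the kernel of
`T`, which is the line spanned by `ξ` (`apply_eq_smul_of_inner_eq`). Also `c ≠ 0`, so `ξ` is
continuous.

Let `z` be a zero of the Fourier transform of `ξ`. Then the solution `η` of `η' = i z η + i ξ` with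
`η 0 = 0` satisfies `η L = 0` too. The kernel of `T` depends only on `x - y`, so its quadratic form
is invariant under translations, infinitesimally `⟪η', T η⟫ + ⟪η, T η'⟫ = 0`
(`integral_mul_convolution_deriv_add_eq_zero`); the vanishing of `η` at both ends removes the
boundary terms. Since `T ξ = 0`, inserting the equation for `η'` leaves `-2 Im z ⟪η, T η⟫ = 0`
(`inner_apply_eq_of_derivation`).

If `z` were not real, `η` would be a multiple of `ξ`; its differential equation would become linear
and homogeneous, so that `η 0 = 0` would force `η = 0` and then `ξ = 0`
(`im_eq_zero_of_complexFourier_eq_zero`).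

Compactness of `K` comes from the Weierstrass theorem: polynomial kernels in `x - y` give operators
of finite rank, and `K` depends continuously on `h` in the uniform norm.
-/

open scoped ComplexConjugate

/-! ### Compactness and selfadjointness of the convolution operator -/

/-- A bounded operator whose range lies in a finite-dimensional subspace is compact. -/
theorem isCompactOperator_of_forall_mem {E F : Type*} [NormedAddCommGroup E] [NormedSpace ℂ E]
    [NormedAddCommGroup F] [NormedSpace ℂ F] (V : Submodule ℂ F) [FiniteDimensional ℂ V]
    (T : E →L[ℂ] F) (hT : ∀ x, T x ∈ V) : IsCompactOperator T := by
  have : ProperSpace V := FiniteDimensional.proper ℂ V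
  exact (isCompactOperator_of_locallyCompactSpace_dom (T.codRestrict V hT)).clm_comp V.subtypeL

theorem Continuous.memLp_restrict_Icc {u : ℝ → ℂ} (hu : Continuous u) (L : ℝ) :
    MemLp u 2 (volume.restrict (Icc (0 : ℝ) L)) := by
  obtain ⟨C, hC⟩ := isCompact_Icc.exists_bound_of_continuousOn (hu.continuousOn (s := Icc 0 L))
  refine MemLp.of_bound hu.aestronglyMeasurable C ?_
  filter_upwards [ae_restrict_mem measurableSet_Icc] with x hx using hC x hx

/-- The kernel `p (x - y)` of a polynomial `p` is degenerate, so that its convolution operator has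
values in the span of the monomials of degree at most `deg p`. -/
theorem isCompactOperator_convOp_polynomial (L : ℝ) (p : Polynomial ℝ)
    (hp : ContinuousOn (fun x => p.eval x) (Icc (-L) L)) :
    IsCompactOperator (convOp L (fun x => p.eval x) hp) := by
  have hmono (k : ℕ) : MemLp (fun x : ℝ => (x : ℂ) ^ k) 2 (volume.restrict (Icc (0 : ℝ) L)) :=
    Continuous.memLp_restrict_Icc (by fun_prop) L
  let V : Submodule ℂ (L2Interval L) :=
    Submodule.span ℂ (range fun k : Fin (p.natDegree + 1) => (hmono k).toLp _)
  have : FiniteDimensional ℂ V := FiniteDimensional.span_of_finite ℂ (finite_range _)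
  refine isCompactOperator_of_forall_mem V _ fun f => ?_
  let q (k : ℕ) (y : ℝ) : ℂ := ((Polynomial.hasseDeriv k p).eval (-y) : ℝ)
  have hf : Integrable f (volume.restrict (Icc 0 L)) := (Lp.memLp f).integrable (by norm_num)
  have hq (k : ℕ) : Integrable (fun y => q k y * f y) (volume.restrict (Icc 0 L)) := by
    have hc : Continuous (q k) := by fun_prop
    obtain ⟨M, hM⟩ := isCompact_Icc.exists_bound_of_continuousOn (hc.continuousOn (s := Icc 0 L))
    refine hf.bdd_mul (c := M) hc.aestronglyMeasurable ?_
    filter_upwards [ae_restrict_mem measurableSet_Icc] with y hy using hM y hy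
  have hsum : convOp L (fun x => p.eval x) hp f = ∑ k : Fin (p.natDegree + 1),
      (∫ y in Icc 0 L, q k y * f y) • (hmono k).toLp _ := by
    refine Lp.ext ?_
    have h1 := Lp.coeFn_finsetSum (Finset.univ : Finset (Fin (p.natDegree + 1)))
      (fun k => (∫ y in Icc 0 L, q k y * f y) • (hmono k).toLp _)
    have h2 : ∀ᵐ x ∂volume.restrict (Icc (0 : ℝ) L), ∀ k : Fin (p.natDegree + 1),
        ((∫ y in Icc 0 L, q k y * f y) • (hmono k).toLp _ : L2Interval L) x =
          (∫ y in Icc 0 L, q k y * f y) * (x : ℂ) ^ (k : ℕ) := by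
      refine ae_all_iff.2 fun k => ?_
      filter_upwards [Lp.coeFn_smul (∫ y in Icc 0 L, q k y * f y) ((hmono k).toLp _),
        (hmono k).coeFn_toLp] with x h3 h4
      rw [h3, Pi.smul_apply, h4, smul_eq_mul]
    filter_upwards [convOp_coeFn hp f, h1, h2] with x hx h3 h4
    rw [hx, h3, Finset.sum_apply]
    simp only [h4]
    rw [Fin.sum_univ_eq_sum_range
      (fun k => (∫ y in Icc 0 L, q k y * f y) * (x : ℂ) ^ k) (p.natDegree + 1)]
    simp_rw [← integral_mul_const]
    rw [← integral_finsetSum _ fun k _ => (hq k).mul_const _]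
    refine integral_congr_ae (.of_forall fun y => ?_)
    have h5 : p.eval (x - y) =
        ∑ k ∈ Finset.range (p.natDegree + 1), (Polynomial.hasseDeriv k p).eval (-y) * x ^ k := by
      rw [sub_eq_add_neg, ← Polynomial.taylor_eval, Polynomial.eval_eq_sum_range,
        Polynomial.natDegree_taylor]
      simp_rw [Polynomial.taylor_coeff]
    simp only [h5, q]
    push_cast
    rw [Finset.sum_mul]
    exact Finset.sum_congr rfl fun k _ => by ring
  rw [hsum]
  exact Submodule.sum_mem _ fun k _ =>
    Submodule.smul_mem _ _ (Submodule.subset_span (mem_range_self k))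

theorem integral_norm_le_mul_norm (L : ℝ) : ∃ C : ℝ, 0 ≤ C ∧
    ∀ f : L2Interval L, ∫ y in Icc (0 : ℝ) L, ‖f y‖ ≤ C * ‖f‖ := by
  let μ : Measure ℝ := volume.restrict (Icc (0 : ℝ) L)
  refine ⟨(μ univ ^ (1 / (2 : ℝ))).toReal, by positivity, fun f => ?_⟩
  have hf : Integrable f μ := (Lp.memLp f).integrable (by norm_num)
  have h3 := eLpNorm_le_eLpNorm_mul_rpow_measure_univ (p := 1) (q := 2) (μ := μ)
    (by norm_num) (Lp.aestronglyMeasurable f)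
  rw [integral_norm_eq_lintegral_enorm hf.1, ← eLpNorm_one_eq_lintegral_enorm, Lp.norm_def,
    mul_comm, ← ENNReal.toReal_mul]
  have h4 : (1 / (1 : ENNReal).toReal - 1 / (2 : ENNReal).toReal) = 1 / (2 : ℝ) := by norm_num
  rw [h4] at h3
  refine ENNReal.toReal_mono (ENNReal.mul_ne_top (Lp.memLp f).2.ne ?_) h3
  exact ENNReal.rpow_ne_top_of_nonneg (by norm_num) (measure_ne_top μ _)

/-- The convolution operator depends continuously on its kernel, in the uniform norm. -/
theorem exists_norm_convOp_sub_le (L : ℝ) : ∃ C : ℝ, 0 ≤ C ∧ ∀ (h k : ℝ → ℝ)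
    (hc : ContinuousOn h (Icc (-L) L)) (kc : ContinuousOn k (Icc (-L) L)) (ε : ℝ), 0 ≤ ε →
    (∀ x ∈ Icc (-L) L, |h x - k x| ≤ ε) → ‖convOp L h hc - convOp L k kc‖ ≤ C * ε := by
  obtain ⟨C, hC0, hC⟩ := integral_norm_le_mul_norm L
  refine ⟨(volume.restrict (Icc (0 : ℝ) L)).real univ ^ (2 : ENNReal).toReal⁻¹ * C, by positivity,
    fun h k hc kc ε hε hhk => ContinuousLinearMap.opNorm_le_bound _ (by positivity) fun f => ?_⟩
  have hf : Integrable f (volume.restrict (Icc 0 L)) := (Lp.memLp f).integrable (by norm_num)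
  have : (volume.restrict (Icc (0 : ℝ) L)).real univ ^ (2 : ENNReal).toReal⁻¹ * C * ε * ‖f‖ =
    (volume.restrict (Icc (0 : ℝ) L)).real univ ^ (2 : ENNReal).toReal⁻¹ * (ε * (C * ‖f‖)) := by
      ring
  rw [this]
  refine Lp.norm_le_of_ae_bound (by positivity) ?_
  filter_upwards [ae_restrict_mem measurableSet_Icc, convOp_coeFn hc f, convOp_coeFn kc f,
    Lp.coeFn_sub (convOp L h hc f) (convOp L k kc f)] with x hx h1 h2 h3
  rw [sub_apply, h3, Pi.sub_apply, h1, h2,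
    ← integral_sub (kernel_mul_integrable hc f hx) (kernel_mul_integrable kc f hx)]
  refine (norm_integral_le_of_norm_le (hf.norm.const_mul ε) ?_).trans ?_
  · filter_upwards [ae_restrict_mem measurableSet_Icc] with y hy
    rw [← sub_mul, norm_mul, ← Complex.ofReal_sub, Complex.norm_real]
    refine mul_le_mul_of_nonneg_right (hhk _ ?_) (norm_nonneg _)
    simp only [mem_Icc] at *
    constructor <;> linarith
  · rw [integral_const_mul]
    exact mul_le_mul_of_nonneg_left (hC f) hε

theorem isCompactOperator_convOp (L : ℝ) (h : ℝ → ℝ) (hc : ContinuousOn h (Icc (-L) L)) :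
    IsCompactOperator (convOp L h hc) := by
  obtain ⟨C, hC0, hC⟩ := exists_norm_convOp_sub_le L
  have key : convOp L h hc ∈
      closure {T : L2Interval L →L[ℂ] L2Interval L | IsCompactOperator T} := by
    refine Metric.mem_closure_iff.2 fun δ hδ => ?_
    obtain ⟨p, hp⟩ := exists_polynomial_near_of_continuousOn (-L) L h hc (δ / (C + 1))
      (by positivity)
    refine ⟨_, isCompactOperator_convOp_polynomial L p p.continuous.continuousOn, ?_⟩
    rw [dist_eq_norm]
    refine (hC _ _ hc _ (δ / (C + 1)) (by positivity)
      fun x hx => (abs_sub_comm _ _).trans_le (hp x hx).le).trans_lt ?_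
    rw [mul_div_assoc', div_lt_iff₀ (by positivity)]
    nlinarith
  rwa [isClosed_setOfPred_isCompactOperator.closure_eq] at key

theorem isSelfAdjoint_convOp (L : ℝ) (h : ℝ → ℝ) (hc : ContinuousOn h (Icc (-L) L))
    (heven : ∀ x ∈ Icc (-L) L, h (-x) = h x) : IsSelfAdjoint (convOp L h hc) := by
  rw [ContinuousLinearMap.isSelfAdjoint_iff_isSymmetric]
  intro f g
  let μ : Measure ℝ := volume.restrict (Icc (0 : ℝ) L)
  have hf : Integrable f μ := (Lp.memLp f).integrable (by norm_num)
  have hg : Integrable g μ := (Lp.memLp g).integrable (by norm_num)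
  have hmem : ∀ᵐ p ∂(μ.prod μ), p ∈ Icc (0 : ℝ) L ×ˢ Icc (0 : ℝ) L := by
    rw [Measure.prod_restrict]
    exact ae_restrict_mem (measurableSet_Icc.prod measurableSet_Icc)
  have hint : Integrable (Function.uncurry fun x y : ℝ =>
      (h (x - y) : ℂ) * (g x * starRingEnd ℂ (f y))) (μ.prod μ) := by
    obtain ⟨M, -, hM⟩ := kernel_bound hc
    have hconj : Integrable (fun y => starRingEnd ℂ (f y)) μ :=
      Complex.conjCLE.toContinuousLinearMap.integrable_comp hf
    refine (hg.mul_prod hconj).bdd_mul (c := M) ?_ ?_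
    · rw [Measure.prod_restrict]
      exact (kernel_continuousOn hc).aestronglyMeasurable
        (measurableSet_Icc.prod measurableSet_Icc)
    · filter_upwards [hmem] with p hp using hM _ hp.1 _ hp.2
  rw [ContinuousLinearMap.coe_coe, L2.inner_def, L2.inner_def]
  have h1 : ∫ x, inner ℂ (convOp L h hc f x) (g x) ∂μ =
      ∫ x, ∫ y, (h (x - y) : ℂ) * (g x * starRingEnd ℂ (f y)) ∂μ ∂μ := by
    refine integral_congr_ae ?_
    filter_upwards [convOp_coeFn hc f] with x hx
    rw [hx, RCLike.inner_apply, ← integral_conj, ← integral_const_mul]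
    refine integral_congr_ae (.of_forall fun y => ?_)
    simp only [map_mul, Complex.conj_ofReal]
    ring
  have h2 : ∫ y, inner ℂ (f y) (convOp L h hc g y) ∂μ =
      ∫ y, ∫ x, (h (x - y) : ℂ) * (g x * starRingEnd ℂ (f y)) ∂μ ∂μ := by
    refine integral_congr_ae ?_
    filter_upwards [convOp_coeFn hc g, ae_restrict_mem measurableSet_Icc] with y hy hyI
    rw [hy, RCLike.inner_apply, ← integral_mul_const]
    refine integral_congr_ae ?_
    filter_upwards [ae_restrict_mem measurableSet_Icc] with x hxI
    rw [← heven (x - y), neg_sub]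
    · ring
    · simp only [mem_Icc] at *
      constructor <;> linarith
  rw [h1, h2, integral_integral_swap hint]

/-! ### Extremal eigenvalues of compact selfadjoint operators -/

/-- The norm of a compact selfadjoint operator is attained as the modulus of an eigenvalue. -/
theorem IsCompactOperator.opNorm_le_of_hasEigenvalue_le {E : Type*} [NormedAddCommGroup E]
    [InnerProductSpace ℂ E] [CompleteSpace E] [Nontrivial E] {T : E →L[ℂ] E}
    (hT : IsCompactOperator T) (hsa : IsSelfAdjoint T) {r : ℝ} (hr : 0 ≤ r)
    (hle : ∀ μ : ℂ, Module.End.HasEigenvalue (T : Module.End ℂ E) μ → ‖μ‖ ≤ r) : ‖T‖ ≤ r := by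
  obtain ⟨z, hz, hzr⟩ := spectrum.exists_nnnorm_eq_spectralRadius T
  rw [T.spectralRadius_eq_nnnorm hsa, ENNReal.coe_inj] at hzr
  have hnorm : ‖z‖ = ‖T‖ := congrArg NNReal.toReal hzr
  rcases eq_or_ne z 0 with rfl | hz0
  · rwa [← hnorm, norm_zero]
  · exact hnorm ▸ hle z ((hT.hasEigenvalue_iff_mem_spectrum hz0).2 hz)

/-- A vector at which the quadratic form of `T` attains the extremal value `c ‖u‖²` is an
eigenvector: `‖T u - c u‖² ≤ 2 c (c ‖u‖² - re ⟪u, T u⟫)` as soon as `‖T‖ ≤ |c|`, for either sign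
of `c`. -/
theorem apply_eq_smul_of_inner_eq {E : Type*} [NormedAddCommGroup E] [InnerProductSpace ℂ E]
    {T : E →L[ℂ] E} {c : ℝ} (hT : ‖T‖ ≤ |c|) {u : E}
    (hu : inner ℂ u (T u) = (c : ℂ) * inner ℂ u u) : T u = (c : ℂ) • u := by
  rw [← sub_eq_zero, ← norm_eq_zero, ← sq_eq_zero_iff]
  refine le_antisymm ?_ (by positivity)
  have h1 : RCLike.re (inner ℂ (T u) ((c : ℂ) • u)) = c ^ 2 * ‖u‖ ^ 2 := by
    rw [inner_re_symm, inner_smul_left, hu, inner_self_eq_norm_sq_to_K]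
    simp only [Complex.conj_ofReal, Complex.coe_algebraMap, RCLike.re_to_complex]
    norm_cast
    ring
  have h2 : ‖T u‖ ≤ |c| * ‖u‖ := (T.le_opNorm u).trans (by gcongr)
  have h3 : ‖T u‖ ^ 2 ≤ c ^ 2 * ‖u‖ ^ 2 := by
    rw [← sq_abs c, ← mul_pow]; gcongr
  rw [@norm_sub_sq ℂ, h1, norm_smul, mul_pow, Complex.norm_real, Real.norm_eq_abs, sq_abs]
  linarith

/-! ### Infinitesimal translation invariance -/

/-- If `u` and `v` vanish at `0` and `L`, then the form `(v, u) ↦ ∫∫ v(x) k(x - y) u(y) dy dx`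
annihilates the derivation `(v, u) ↦ (v, u') + (v', u)`: this is the infinitesimal form of its
invariance under translations. Both terms are expressed through a primitive `P` of `k` as
`± ∫∫ v'(x) P(x - y) u'(y) dy dx`, so `k` need not be differentiable. -/
theorem integral_mul_convolution_deriv_add_eq_zero {L : ℝ} {k u u' v v' : ℝ → ℂ}
    (hk : Continuous k) (hu : ∀ x, HasDerivAt u (u' x) x) (hu' : Continuous u')
    (hv : ∀ x, HasDerivAt v (v' x) x) (hv' : Continuous v')
    (hu0 : u 0 = 0) (huL : u L = 0) (hv0 : v 0 = 0) (hvL : v L = 0) :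
    (∫ x in 0..L, v x * ∫ y in 0..L, k (x - y) * u' y) +
      ∫ x in 0..L, v' x * ∫ y in 0..L, k (x - y) * u y = 0 := by
  have hvc : Continuous v := continuous_iff_continuousAt.2 fun x => (hv x).continuousAt
  let P (t : ℝ) : ℂ := ∫ s in 0..t, k s
  have hP (t : ℝ) : HasDerivAt P (k t) t :=
    intervalIntegral.integral_hasDerivAt_right (hk.intervalIntegrable _ _)
      (hk.stronglyMeasurableAtFilter _ _) hk.continuousAt
  have hPc : Continuous P := continuous_iff_continuousAt.2 fun x => (hP x).continuousAt
  have hy (x : ℝ) : ∫ y in 0..L, k (x - y) * u y = ∫ y in 0..L, P (x - y) * u' y := by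
    have hd (y : ℝ) : HasDerivAt (fun y => P (x - y)) (-k (x - y)) y := by
      simpa [Function.comp_def] using (hP (x - y)).scomp y ((hasDerivAt_id y).const_sub x)
    rw [intervalIntegral.integral_mul_deriv_eq_deriv_mul (fun y _ => hd y) (fun y _ => hu y)
      (Continuous.intervalIntegrable (by fun_prop) _ _)
      (Continuous.intervalIntegrable (by fun_prop) _ _), hu0, huL]
    simp
  have hx (y : ℝ) : ∫ x in 0..L, v x * k (x - y) = -∫ x in 0..L, v' x * P (x - y) := by
    have hd (x : ℝ) : HasDerivAt (fun x => P (x - y)) (k (x - y)) x := by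
      simpa [Function.comp_def] using (hP (x - y)).scomp x ((hasDerivAt_id x).sub_const y)
    rw [intervalIntegral.integral_mul_deriv_eq_deriv_mul (fun x _ => hv x) (fun x _ => hd x)
      (Continuous.intervalIntegrable (by fun_prop) _ _)
      (Continuous.intervalIntegrable (by fun_prop) _ _), hv0, hvL]
    simp
  have hswap (w : ℝ → ℂ) (Q : ℝ → ℂ) (hw : Continuous w) (hQ : Continuous Q) :
      ∫ x in 0..L, w x * ∫ y in 0..L, Q (x - y) * u' y =
        ∫ y in 0..L, (∫ x in 0..L, w x * Q (x - y)) * u' y := by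
    simp_rw [← intervalIntegral.integral_const_mul, ← intervalIntegral.integral_mul_const,
      ← mul_assoc]
    refine intervalIntegral_intervalIntegral_swap ?_
    refine (Continuous.integrableOn_Icc (a := (min 0 L, min 0 L)) (b := (max 0 L, max 0 L))
      (by fun_prop)).mono_set ?_
    rw [← Icc_prod_Icc]
    exact prod_mono Ioc_subset_Icc_self Ioc_subset_Icc_self
  simp_rw [hy]
  rw [hswap v k hvc hk, hswap v' P hv' hPc]
  simp_rw [hx, neg_mul]
  rw [intervalIntegral.integral_neg, neg_add_cancel]

/-- Let `U' = a U + b ξ` where `T ξ = c ξ`. If the forms of `1` and of `T` both annihilate the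
derivation `U ↦ U'`, then the form of `T - c` does too, and `ξ` drops out of it, so that
`(a + conj a) ⟪U, (T - c) U⟫ = 0`. -/
theorem inner_apply_eq_of_derivation {E : Type*} [NormedAddCommGroup E] [InnerProductSpace ℂ E]
    {T : E →L[ℂ] E} (hT : (T : E →ₗ[ℂ] E).IsSymmetric) {c : ℝ} {a b : ℂ} {ξ U W : E}
    (hξ : T ξ = (c : ℂ) • ξ) (hW : W = a • U + b • ξ) (ha : a + conj a ≠ 0)
    (h1 : inner ℂ U W + inner ℂ W U = 0) (h2 : inner ℂ U (T W) + inner ℂ W (T U) = 0) :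
    inner ℂ U (T U) = (c : ℂ) * inner ℂ U U := by
  have h3 : inner ℂ ξ (T U) = (c : ℂ) * inner ℂ ξ U := by
    rw [← ContinuousLinearMap.coe_coe, ← hT, ContinuousLinearMap.coe_coe, hξ, inner_smul_left,
      Complex.conj_ofReal]
  subst hW
  simp only [map_add, map_smul, hξ, inner_add_left, inner_add_right, inner_smul_left,
    inner_smul_right, h3] at h1 h2
  have : (a + conj a) * (inner ℂ U (T U) - (c : ℂ) * inner ℂ U U) = 0 := by
    linear_combination h2 - (c : ℂ) * h1
  exact sub_eq_zero.1 ((mul_eq_zero.1 this).resolve_left ha)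

/-! ### Continuous representatives -/

/-- The continuous function on `ℝ` that agrees with `h` on `[-L, L]` and is constant on either side
of that interval; only the values of `h` on `[-L, L]` enter `convOp`. -/
noncomputable def kernelExtension {L : ℝ} (hL : 0 ≤ L) (h : ℝ → ℝ) (t : ℝ) : ℂ :=
  ((IccExtend (neg_le_self hL) ((Icc (-L) L).domRestrict h) t : ℝ) : ℂ)

theorem continuous_kernelExtension {L : ℝ} (hL : 0 ≤ L) {h : ℝ → ℝ}
    (hc : ContinuousOn h (Icc (-L) L)) : Continuous (kernelExtension hL h) :=
  Complex.continuous_ofReal.comp hc.domRestrict.Icc_extend'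

theorem kernelExtension_sub {L : ℝ} (hL : 0 ≤ L) (h : ℝ → ℝ) {x y : ℝ} (hx : x ∈ Icc 0 L)
    (hy : y ∈ Icc 0 L) : kernelExtension hL h (x - y) = h (x - y) := by
  rw [kernelExtension, IccExtend_of_mem (neg_le_self hL) _ (x := x - y)]
  · rfl
  · simp only [mem_Icc] at *
    constructor <;> linarith

/-- Eigenvectors of the convolution operator for non-zero eigenvalues are continuous. -/
theorem exists_continuous_ae_eq {L : ℝ} (hL : 0 ≤ L) {h : ℝ → ℝ}
    (hc : ContinuousOn h (Icc (-L) L)) {lam : ℂ} (hlam : lam ≠ 0) {ξ : L2Interval L}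
    (hξ : convOp L h hc ξ = lam • ξ) :
    ∃ g : ℝ → ℂ, Continuous g ∧ ξ =ᵐ[volume.restrict (Icc (0 : ℝ) L)] g := by
  have hk := continuous_kernelExtension hL hc
  have hint : Integrable ξ (volume.restrict (Icc 0 L)) := (Lp.memLp ξ).integrable (by norm_num)
  obtain ⟨M, hM⟩ := isCompact_Icc.exists_bound_of_continuousOn hc
  refine ⟨fun x => lam⁻¹ * ∫ y in Icc 0 L, kernelExtension hL h (x - y) * ξ y, ?_, ?_⟩
  · refine continuous_const.mul (continuous_of_dominated (bound := fun y => M * ‖ξ y‖) ?_ ?_ ?_ ?_)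
    · intro x
      exact (Continuous.aestronglyMeasurable (by fun_prop)).mul hint.1
    · refine fun x => .of_forall fun y => ?_
      rw [norm_mul]
      refine mul_le_mul_of_nonneg_right ?_ (norm_nonneg _)
      rw [kernelExtension, Complex.norm_real]
      exact hM _ (projIcc (-L) L (neg_le_self hL) (x - y)).2
    · exact hint.norm.const_mul M
    · exact .of_forall fun y => by fun_prop
  · have h1 := convOp_coeFn hc ξ
    rw [hξ] at h1
    filter_upwards [h1, Lp.coeFn_smul lam ξ, ae_restrict_mem measurableSet_Icc] with x h2 h3 hx
    rw [eq_inv_mul_iff_mul_eq₀ hlam, ← smul_eq_mul, ← Pi.smul_apply, ← h3, h2]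
    refine setIntegral_congr_fun measurableSet_Icc fun y hy => ?_
    simp only [kernelExtension_sub hL h hx hy]

theorem inner_toLp_toLp {L : ℝ} (hL : 0 ≤ L) {v w : ℝ → ℂ} (hv : Continuous v)
    (hw : Continuous w) :
    inner ℂ ((hv.memLp_restrict_Icc L).toLp v) ((hw.memLp_restrict_Icc L).toLp w) =
      ∫ x in 0..L, conj (v x) * w x := by
  rw [L2.inner_def, intervalIntegral.integral_of_le hL, ← integral_Icc_eq_integral_Ioc]
  refine integral_congr_ae ?_
  filter_upwards [(hv.memLp_restrict_Icc L).coeFn_toLp, (hw.memLp_restrict_Icc L).coeFn_toLp]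
    with x h1 h2
  rw [h1, h2, RCLike.inner_apply, mul_comm]

theorem inner_toLp_convOp_toLp {L : ℝ} (hL : 0 ≤ L) {h : ℝ → ℝ}
    (hc : ContinuousOn h (Icc (-L) L)) {v w : ℝ → ℂ} (hv : Continuous v) (hw : Continuous w) :
    inner ℂ ((hv.memLp_restrict_Icc L).toLp v)
        (convOp L h hc ((hw.memLp_restrict_Icc L).toLp w)) =
      ∫ x in 0..L, conj (v x) * ∫ y in 0..L, kernelExtension hL h (x - y) * w y := by
  rw [L2.inner_def, intervalIntegral.integral_of_le hL, ← integral_Icc_eq_integral_Ioc]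
  refine integral_congr_ae ?_
  filter_upwards [(hv.memLp_restrict_Icc L).coeFn_toLp, convOp_coeFn hc _,
    ae_restrict_mem measurableSet_Icc] with x h1 h2 hx
  rw [h1, h2, RCLike.inner_apply, mul_comm, intervalIntegral.integral_of_le hL,
    ← integral_Icc_eq_integral_Ioc]
  congr 1
  refine integral_congr_ae ?_
  filter_upwards [(hw.memLp_restrict_Icc L).coeFn_toLp, ae_restrict_mem measurableSet_Icc]
    with y h3 hy
  rw [h3, kernelExtension_sub hL h hx hy]

/-- If `‖T‖ ≤ |c|` and the eigenspace of `T` for `c` is spanned by `ξ`, then `c ≠ 0`: otherwise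
`L²([0, L])` itself would be a line, although `1` and `x` are linearly independent in it. -/
theorem ne_zero_of_forall_exists_smul_eq {L : ℝ} (hL : 0 < L) {T : L2Interval L →L[ℂ] L2Interval L}
    {c : ℝ} (hT : ‖T‖ ≤ |c|) {ξ : L2Interval L}
    (hsimple : ∀ w, T w = (c : ℂ) • w → ∃ d : ℂ, d • ξ = w) : c ≠ 0 := by
  rintro rfl
  have hT0 : T = 0 := norm_le_zero_iff.1 (by simpa using hT)
  subst hT0
  have h1 : Continuous fun _ : ℝ => (1 : ℂ) := continuous_const
  have h2 : Continuous fun x : ℝ => (x : ℂ) := Complex.continuous_ofReal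
  obtain ⟨a, ha⟩ := hsimple ((h1.memLp_restrict_Icc L).toLp _) (by simp)
  obtain ⟨b, hb⟩ := hsimple ((h2.memLp_restrict_Icc L).toLp _) (by simp)
  have h3 : (fun _ : ℝ => b) =ᵐ[volume.restrict (Icc (0 : ℝ) L)] fun x => a * (x : ℂ) := by
    have hba : b • (a • ξ) = a • (b • ξ) := smul_comm _ _ _
    rw [ha, hb] at hba
    filter_upwards [(h1.memLp_restrict_Icc L).coeFn_toLp, (h2.memLp_restrict_Icc L).coeFn_toLp,
      Lp.coeFn_smul b ((h1.memLp_restrict_Icc L).toLp _),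
      Lp.coeFn_smul a ((h2.memLp_restrict_Icc L).toLp _)] with x e1 e2 e3 e4
    rw [← hba, e3, Pi.smul_apply, Pi.smul_apply, e1, e2] at e4
    simpa using e4
  have h4 := Measure.eqOn_Icc_of_ae_eq volume hL.ne h3 (by fun_prop) (by fun_prop)
  have hb0 : b = 0 := by simpa using h4 (left_mem_Icc.2 hL.le)
  have ha0 : a = 0 := by
    have := h4 (right_mem_Icc.2 hL.le)
    simpa [hb0, hL.ne', eq_comm] using this
  rw [ha0, zero_smul] at ha
  have h5 := (h1.memLp_restrict_Icc L).coeFn_toLp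
  rw [← ha] at h5
  have h6 := Measure.eqOn_Icc_of_ae_eq volume hL.ne ((Lp.coeFn_zero _ _ _).symm.trans h5)
    continuousOn_const continuousOn_const (left_mem_Icc.2 hL.le)
  simp at h6

/-! ### The Fourier transform of a compactly supported function -/

theorem complexFourier_extendByZero {L : ℝ} (f : L2Interval L) (z : ℂ) :
    complexFourier (extendByZero f) z =
      ∫ x in Icc (0 : ℝ) L, f x * Complex.exp (-Complex.I * z * x) := by
  rw [complexFourier, ← integral_indicator measurableSet_Icc]
  congr 1 with x
  rw [extendByZero, indicator_mul_left]

theorem differentiable_complexFourier_extendByZero {L : ℝ} (f : L2Interval L) :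
    Differentiable ℂ (complexFourier (extendByZero f)) := by
  have hf : Integrable f (volume.restrict (Icc 0 L)) := (Lp.memLp f).integrable (by norm_num)
  rw [funext (complexFourier_extendByZero f)]
  intro z
  have hmeas (w : ℂ) : AEStronglyMeasurable
      (fun x : ℝ => f x * Complex.exp (-Complex.I * w * x)) (volume.restrict (Icc 0 L)) :=
    hf.1.mul (Continuous.aestronglyMeasurable (by fun_prop))
  have hexp (w : ℂ) (hw : w ∈ Metric.ball z 1) (x : ℝ) (hx : x ∈ Icc 0 L) :
      ‖Complex.exp (-Complex.I * w * x)‖ ≤ Real.exp ((‖z‖ + 1) * L) := by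
    rw [Complex.norm_exp, Real.exp_le_exp]
    refine (Complex.re_le_norm _).trans ?_
    rw [norm_mul, norm_mul, norm_neg, Complex.norm_I, one_mul, Complex.norm_real,
      Real.norm_of_nonneg hx.1]
    have : ‖w‖ ≤ ‖z‖ + 1 := by
      rw [mem_ball_iff_norm] at hw
      linarith [norm_le_norm_add_norm_sub z w, norm_sub_rev z w]
    exact mul_le_mul this hx.2 hx.1 (by positivity)
  refine (hasDerivAt_integral_of_dominated_loc_of_deriv_le
    (F' := fun w (x : ℝ) => f x * (Complex.exp (-Complex.I * w * x) * (-Complex.I * x)))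
    (bound := fun x => ‖f x‖ * (Real.exp ((‖z‖ + 1) * L) * L))
    (Metric.ball_mem_nhds z one_pos) (.of_forall hmeas) ?_ ?_ ?_ ?_ ?_).2.differentiableAt
  · refine Integrable.mono' (hf.norm.mul_const (Real.exp ((‖z‖ + 1) * L))) (hmeas z) ?_
    filter_upwards [ae_restrict_mem measurableSet_Icc] with x hx
    rw [norm_mul]
    gcongr
    exact hexp z (Metric.mem_ball_self one_pos) x hx
  · exact hf.1.mul (Continuous.aestronglyMeasurable (by fun_prop))
  · filter_upwards [ae_restrict_mem measurableSet_Icc] with x hx w hw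
    rw [norm_mul, norm_mul, norm_mul, norm_neg, Complex.norm_I, one_mul, Complex.norm_real,
      Real.norm_of_nonneg hx.1]
    gcongr
    · exact hx.1
    · exact hexp w hw x hx
    · exact hx.2
  · exact hf.norm.mul_const _
  · refine .of_forall fun x w _ => HasDerivAt.const_mul _ (HasDerivAt.cexp ?_)
    simpa using ((hasDerivAt_id w).const_mul (-Complex.I)).mul_const (x : ℂ)

theorem memLp_extendByZero {L : ℝ} (f : L2Interval L) : MemLp (extendByZero f) 2 volume :=
  (memLp_indicator_iff_restrict measurableSet_Icc).2 (Lp.memLp f)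

/-! ### Zeros of the Fourier transform -/

/-- If a multiple `d F'` equals `b F` on `[0, L]`, where `b ≠ 0` and `F 0 = 0`, then `F' = 0` on
`(0, L)`; for `d = 0` the equation itself says that `F = 0`. -/
theorem deriv_eq_zero_of_smul_deriv_eq {L : ℝ} {F F' : ℝ → ℂ} (hF : ∀ x, HasDerivAt F (F' x) x)
    (hF0 : F 0 = 0) {b d : ℂ} (hb : b ≠ 0) (hd : ∀ x ∈ Icc 0 L, d * F' x = b * F x) :
    ∀ x ∈ Ioo 0 L, F' x = 0 := by
  have hzero : ∀ x ∈ Icc 0 L, F x = 0 := by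
    rcases eq_or_ne d 0 with rfl | hd0
    · intro x hx
      simpa [hb] using (hd x hx).symm
    · refine eq_zero_of_abs_deriv_le_mul_abs_self_of_eq_zero_right (f' := F') (K := ‖b / d‖)
        (fun x _ => (hF x).continuousAt.continuousWithinAt) (fun x _ => (hF x).hasDerivWithinAt)
        hF0 fun x hx => ?_
      rw [← norm_mul, div_mul_eq_mul_div, ← hd x (Ico_subset_Icc_self hx),
        mul_div_cancel_left₀ _ hd0]
  intro x hx
  refine (hF x).unique ((hasDerivAt_const x (0 : ℂ)).congr_of_eventuallyEq ?_)
  filter_upwards [Icc_mem_nhds hx.1 hx.2] with y hy using hzero y hy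

/-- With `T = c - convOp L h`, a non-real zero `z` of the Fourier transform of `ξ` gives a vector
`U` with `⟪U, T U⟫ = 0`, so that `U` is a multiple `d ξ` of `ξ`. But then `U`, which vanishes at
`0`, solves a linear first-order equation, which forces `ξ = 0`. -/
theorem im_eq_zero_of_complexFourier_eq_zero {L : ℝ} (hL : 0 < L) {h : ℝ → ℝ}
    (hc : ContinuousOn h (Icc (-L) L)) (hsa : IsSelfAdjoint (convOp L h hc)) {c : ℝ}
    (hnorm : ‖convOp L h hc‖ ≤ |c|) {ξ : L2Interval L} (hξ0 : ξ ≠ 0)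
    (hξ : convOp L h hc ξ = (c : ℂ) • ξ)
    (hsimple : ∀ w, convOp L h hc w = (c : ℂ) • w → ∃ d : ℂ, d • ξ = w) {z : ℂ}
    (hz : complexFourier (extendByZero ξ) z = 0) : z.im = 0 := by
  -- Since `c ≠ 0`, `ξ` may be replaced by a continuous representative `g`, and `η` below is `C¹`.
  have hc0 : c ≠ 0 := ne_zero_of_forall_exists_smul_eq hL hnorm hsimple
  obtain ⟨g, hg, hξg⟩ := exists_continuous_ae_eq hL.le hc (Complex.ofReal_ne_zero.2 hc0) hξ
  by_contra him
  have hF'c : Continuous fun t : ℝ => Complex.I * (g t * Complex.exp (-Complex.I * z * t)) := by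
    fun_prop
  -- `η = exp (i z x) F` solves `η' = i z η + i g`, that is `(-i d/dx - z) η = g`; on the Fourier
  -- side, `η` is `ξ` divided by `w - z`.
  let F (x : ℝ) : ℂ := ∫ t in 0..x, Complex.I * (g t * Complex.exp (-Complex.I * z * t))
  have hF (x : ℝ) : HasDerivAt F (Complex.I * (g x * Complex.exp (-Complex.I * z * x))) x :=
    intervalIntegral.integral_hasDerivAt_right (hF'c.intervalIntegrable _ _)
      (hF'c.stronglyMeasurableAtFilter _ _) hF'c.continuousAt
  have hF0 : F 0 = 0 := intervalIntegral.integral_same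
  have hFL : F L = 0 := by
    simp only [F]
    rw [intervalIntegral.integral_const_mul, intervalIntegral.integral_of_le hL.le,
      ← integral_Icc_eq_integral_Ioc, ← mul_zero Complex.I, ← hz, complexFourier_extendByZero]
    congr 1
    refine integral_congr_ae ?_
    filter_upwards [hξg] with x hx
    rw [hx]
  let η (x : ℝ) : ℂ := Complex.exp (Complex.I * z * x) * F x
  have hη (x : ℝ) : HasDerivAt η (Complex.I * z * η x + Complex.I * g x) x := by
    have h1 : HasDerivAt (fun x : ℝ => Complex.exp (Complex.I * z * x))
        (Complex.exp (Complex.I * z * x) * (Complex.I * z)) x := by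
      simpa using ((Complex.ofRealCLM.hasDerivAt (x := x)).const_mul (Complex.I * z)).cexp
    have h2 : Complex.exp (Complex.I * z * x) * Complex.exp (-Complex.I * z * x) = 1 := by
      rw [← Complex.exp_add]; simp
    convert! h1.mul (hF x) using 1
    simp only [η]
    linear_combination (-Complex.I * g x) * h2
  have hηc : Continuous η := continuous_iff_continuousAt.2 fun x => (hη x).continuousAt
  have hη'c : Continuous fun x => Complex.I * z * η x + Complex.I * g x := by fun_prop
  have hη0 : η 0 = 0 := by simp [η, hF0]
  have hηL : η L = 0 := by simp [η, hFL]
  have hηconj (x : ℝ) : HasDerivAt (fun x => conj (η x))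
      (conj (Complex.I * z * η x + Complex.I * g x)) x := (hη x).star
  let U : L2Interval L := (hηc.memLp_restrict_Icc L).toLp η
  let W : L2Interval L := (hη'c.memLp_restrict_Icc L).toLp _
  have hW : W = (Complex.I * z) • U + Complex.I • ξ := by
    refine Lp.ext ?_
    filter_upwards [(hη'c.memLp_restrict_Icc L).coeFn_toLp, (hηc.memLp_restrict_Icc L).coeFn_toLp,
      Lp.coeFn_add ((Complex.I * z) • U) (Complex.I • ξ), Lp.coeFn_smul (Complex.I * z) U,
      Lp.coeFn_smul Complex.I ξ, hξg] with x e1 e2 e3 e4 e5 e6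
    rw [e1, e3, Pi.add_apply, e4, e5, Pi.smul_apply, Pi.smul_apply, e2, e6, smul_eq_mul,
      smul_eq_mul]
  have h1 : inner ℂ U W + inner ℂ W U = 0 := by
    rw [inner_toLp_toLp hL.le hηc hη'c, inner_toLp_toLp hL.le hη'c hηc,
      intervalIntegral.integral_mul_deriv_eq_deriv_mul (fun x _ => hηconj x) (fun x _ => hη x)
        (Continuous.intervalIntegrable (by fun_prop) _ _) (hη'c.intervalIntegrable _ _)]
    simp [hη0, hηL]
  have h2 : inner ℂ U (convOp L h hc W) + inner ℂ W (convOp L h hc U) = 0 := by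
    rw [inner_toLp_convOp_toLp hL.le hc hηc hη'c, inner_toLp_convOp_toLp hL.le hc hη'c hηc]
    exact integral_mul_convolution_deriv_add_eq_zero (continuous_kernelExtension hL.le hc) hη hη'c
      hηconj (by fun_prop) hη0 hηL (by simp [hη0]) (by simp [hηL])
  -- `i z + conj (i z) = -2 Im z` is where the assumption that `z` is not real enters.
  have ha : Complex.I * z + conj (Complex.I * z) ≠ 0 := by
    rw [Complex.add_conj]
    simpa using him
  obtain ⟨d, hd⟩ := hsimple U (apply_eq_smul_of_inner_eq hnorm (inner_apply_eq_of_derivation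
    (ContinuousLinearMap.isSelfAdjoint_iff_isSymmetric.1 hsa) hξ hW ha h1 h2))
  have hηg : (fun x => d * g x) =ᵐ[volume.restrict (Icc 0 L)] η := by
    have h3 := (hηc.memLp_restrict_Icc L).coeFn_toLp
    filter_upwards [h3, Lp.coeFn_smul d ξ, hξg] with x e1 e2 e3
    rw [← e1, ← e3, ← smul_eq_mul, ← Pi.smul_apply, ← e2, hd]
  have hηg' := Measure.eqOn_Icc_of_ae_eq volume hL.ne hηg (by fun_prop) hηc.continuousOn
  have hg0 := deriv_eq_zero_of_smul_deriv_eq (L := L) hF hF0 (b := Complex.I) (d := d)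
    Complex.I_ne_zero fun x hx => by
      have h3 : d * g x = Complex.exp (Complex.I * z * x) * F x := hηg' hx
      have h4 : Complex.exp (Complex.I * z * x) * Complex.exp (-Complex.I * z * x) = 1 := by
        rw [← Complex.exp_add]; simp
      linear_combination (Complex.I * Complex.exp (-Complex.I * z * x)) * h3 +
        Complex.I * F x * h4
  refine hξ0 (Lp.ext ?_)
  have hIoo : ∀ᵐ x ∂volume.restrict (Icc (0 : ℝ) L), x ∈ Ioo (0 : ℝ) L :=
    restrict_Ioo_eq_restrict_Icc (μ := (volume : Measure ℝ)) (a := 0) (b := L) ▸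
      ae_restrict_mem measurableSet_Ioo
  filter_upwards [hξg, hIoo, Lp.coeFn_zero ℂ 2 _] with x e1 hx e2
  rw [e1, e2]
  simpa using hg0 x hx

theorem theorem3p1 (L : ℝ) (hL : 0 < L) (h : ℝ → ℝ)
    (hcont : ContinuousOn h (Icc (-L) L))
    (heven : ∀ x ∈ Icc (-L) L, h (-x) = h x) :
    IsCompactOperator (convOp L h hcont) ∧
    IsSelfAdjoint (convOp L h hcont) ∧
    ∀ lam : ℂ,
      Module.End.HasEigenvalue (convOp L h hcont : Module.End ℂ (L2Interval L)) lam →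
      (∀ μ : ℂ, Module.End.HasEigenvalue (convOp L h hcont : Module.End ℂ (L2Interval L)) μ →
        ‖μ‖ ≤ ‖lam‖) →
      Module.finrank ℂ
        (Module.End.eigenspace (convOp L h hcont : Module.End ℂ (L2Interval L)) lam) = 1 →
      ∀ ξ : L2Interval L,
        Module.End.HasEigenvector (convOp L h hcont : Module.End ℂ (L2Interval L)) lam ξ →
        MemLp (extendByZero ξ) 2 volume ∧
        Differentiable ℂ (complexFourier (extendByZero ξ)) ∧
        ∀ z : ℂ, complexFourier (extendByZero ξ) z = 0 → z.im = 0 := by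
  have hcomp := isCompactOperator_convOp L h hcont
  have hsa := isSelfAdjoint_convOp L h hcont heven
  refine ⟨hcomp, hsa, fun lam hlam hmax hsimple ξ hξ => ⟨memLp_extendByZero ξ,
    differentiable_complexFourier_extendByZero ξ, fun z hz => ?_⟩⟩
  obtain ⟨c, rfl⟩ : ∃ c : ℝ, (c : ℂ) = lam := Complex.conj_eq_iff_real.1
    ((ContinuousLinearMap.isSelfAdjoint_iff_isSymmetric.1 hsa).conj_eigenvalue_eq_self hlam) |>.imp
      fun _ => Eq.symm
  have : Nontrivial (L2Interval L) := ⟨ξ, 0, hξ.2⟩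
  have hnorm := hcomp.opNorm_le_of_hasEigenvalue_le hsa (norm_nonneg _) hmax
  rw [Complex.norm_real, Real.norm_eq_abs] at hnorm
  refine im_eq_zero_of_complexFourier_eq_zero hL hcont hsa hnorm hξ.2 hξ.apply_eq_smul
    (fun w hw => ?_) hz
  obtain ⟨d, hd⟩ := (finrank_eq_one_iff_of_nonzero' (⟨ξ, hξ.1⟩ :
    Module.End.eigenspace (convOp L h hcont : Module.End ℂ (L2Interval L)) (c : ℂ))
    (fun h0 => hξ.2 (congrArg Subtype.val h0))).1 hsimple ⟨w, Module.End.mem_eigenspace_iff.2 hw⟩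
  exact ⟨d, congrArg Subtype.val hd⟩
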